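/- Let $k$ be a field, $S=k[x_1,\dots,x_n]$ with the standard grading, $I\subseteq S$ a graded ideal, and $\delta\ge 0$ an integer. For integers $s\ge 0$ and $p\ge 1$, the $p$-th Macaulay representation of $s$ is the expression $s=\sum_{i=1}^{p}\binom{s_i}{i}$ with integers $0\le s_1<s_2<\cdots<s_p$, where $\binom{a}{b}=0$ if $a<b$; the $s_i$ are the $p$-th Macaulay coefficients of $s$. (1) Let $\delta\ge 1$. Then $\dim_k(S/I)_\delta$ has a unique $\delta$-th Macaulay representation $\dim_k(S/I)_\delta=\sum_{i=1}^{\delta}\binom{t_i}{i}$, and $$\dim_k(S/I)_{\delta+1}\le\sum_{i=1}^{\delta}\binom{t_i+1}{i+1}.$$ (2) Let $n\ge 2$. Then $\dim_k I_\delta$ has a unique $(n-1)$-th Macaulay representation $\dim_k I_\delta=\sum_{i=1}^{n-1}\binom{s_i}{i}$, and $$\dim_k I_{\delta+1}\ge\sum_{\substack{1\le i\le n-1\\ s_i\ge i}}\binom{s_i+1}{i},$$ where the sum runs over the nonvanishing terms of the representation. In particular, if $s_i\ge i$ for all $i$, then $\dim_k I_{\delta+1}\ge\sum_{i=1}^{n-1}\binom{s_i+1}{i}$.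 -/

import Mathlib

attribute [local instance] MvPolynomial.gradedAlgebra

/-- `t` lists the `p`-th Macaulay coefficients of `s`, in increasing order (the
usual index `i = 1, …, p` is `j + 1` for `j : Fin p`): nonnegative integers
`t₁ < ⋯ < t_p` with `s = ∑ᵢ (tᵢ choose i)`, where `(a choose b) = 0` for `a < b`. -/
def IsMacaulayRep (p s : ℕ) (t : Fin p → ℕ) : Prop :=
  StrictMono t ∧ s = ∑ j : Fin p, (t j).choose (j + 1)

noncomputable section

/-- The degree-`d` component `I_d = I ∩ S_d` of an ideal `I` of `S = k[x₁, …, xₙ]`. -/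
def idealComponent {k : Type*} [Field k] {n : ℕ} (I : Ideal (MvPolynomial (Fin n) k)) (d : ℕ) :
    Submodule k (MvPolynomial (Fin n) k) :=
  I.restrictScalars k ⊓ MvPolynomial.homogeneousSubmodule (Fin n) k d

/-- The degree-`d` component `(S/I)_d` of `S/I`: the image of `S_d` under `S → S/I`. -/
def quotientComponent {k : Type*} [Field k] {n : ℕ} (I : Ideal (MvPolynomial (Fin n) k)) (d : ℕ) :
    Submodule k (MvPolynomial (Fin n) k ⧸ I) :=
  (MvPolynomial.homogeneousSubmodule (Fin n) k d).map (Ideal.Quotient.mkₐ k I).toLinearMap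

end

/-!
The leading monomials of `I_δ` form a set `A` of `dim I_δ` monomials of degree `δ`, and the products
of its members with the variables are leading monomials of `I_{δ+1}`. Hence `dim I_{δ+1}` is at
least the size of the upper shadow of `A`, and it remains to bound upper shadows from below.

By the Kruskal–Katona theorem for multisets (Macaulay, Clements–Lindström) this shadow is smallest
when `A` is a lex segment. The proof is an induction on the number of variables and the degree:
shifting the exponents of members of `A` from the last variable to the others does not enlarge the
shadow, and ends in a set which is stable under replacing a factor `xₙ` by any other variable; the
quotient by `xₙ` of a stable set is not larger than that of a lex segment of the same size.

The shadow of a lex segment `L` is measured by splitting off the first variable. If `L` has at most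
as many members as there are multiples of `x₀`, it is `x₀` times a lex segment of smaller degree;
otherwise it consists of all multiples of `x₀` and a lex segment in the other variables. By Pascal's
rule, one of these reductions keeps the Macaulay coefficients and the other one removes the last of
them: the first keeps those of `dim I_δ`, the second those of `dim (S/I)_δ`.
-/

open Finset

theorem sub_single_add_single {σ : Type*} [DecidableEq σ] {u : σ → ℕ} {i : σ} (hi : u i ≠ 0) :
    u - Pi.single i 1 + Pi.single i 1 = u := by
  ext j
  rcases eq_or_ne j i with rfl | hj
  · simp [Nat.sub_add_cancel (Nat.one_le_iff_ne_zero.2 hi)]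
  · simp [hj]

section Shadow

variable {σ : Type*} [Fintype σ] [DecidableEq σ] {d : ℕ} {A B : Finset (σ → ℕ)} {u : σ → ℕ}

/-- The monomials of degree `d` in the variables `σ`, encoded by their exponent vectors. -/
def monomialsOfDegree (σ : Type*) [Fintype σ] [DecidableEq σ] (d : ℕ) : Finset (σ → ℕ) :=
  piAntidiag univ d

theorem mem_monomialsOfDegree : u ∈ monomialsOfDegree σ d ↔ ∑ i, u i = d := by
  simp [monomialsOfDegree]

theorem add_single_mem_monomialsOfDegree {i : σ} :
    u + Pi.single i 1 ∈ monomialsOfDegree σ (d + 1) ↔ u ∈ monomialsOfDegree σ d := by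
  simp [mem_monomialsOfDegree, sum_add_distrib]

theorem card_monomialsOfDegree (σ : Type*) [Fintype σ] [DecidableEq σ] (d : ℕ) :
    #(monomialsOfDegree σ d) = (Fintype.card σ).multichoose d := by
  rw [monomialsOfDegree, ← map_sym_eq_piAntidiag, card_map, sym_univ, card_univ,
    Sym.card_sym_eq_multichoose]

/-- The upper shadow of a set of monomials: all products of a member of the set and a variable.
It is the next degree of the monomial ideal generated by the set. -/
def upperShadow (A : Finset (σ → ℕ)) : Finset (σ → ℕ) :=
  univ.biUnion fun i => A.image (· + Pi.single i 1)

theorem mem_upperShadow : u ∈ upperShadow A ↔ ∃ i, ∃ v ∈ A, v + Pi.single i 1 = u := by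
  simp [upperShadow]

theorem add_single_mem_upperShadow (hu : u ∈ A) (i : σ) : u + Pi.single i 1 ∈ upperShadow A :=
  mem_upperShadow.2 ⟨i, u, hu, rfl⟩

theorem upperShadow_subset_iff :
    upperShadow A ⊆ B ↔ ∀ u ∈ A, ∀ i, u + Pi.single i 1 ∈ B := by
  simp only [upperShadow, biUnion_subset, image_subset_iff, mem_univ, true_imp_iff]
  exact forall_comm.trans (forall_congr' fun _ => forall_comm)

theorem upperShadow_mono (h : A ⊆ B) : upperShadow A ⊆ upperShadow B :=
  upperShadow_subset_iff.2 fun _ hu => add_single_mem_upperShadow (h hu)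

theorem upperShadow_subset_monomialsOfDegree (hA : A ⊆ monomialsOfDegree σ d) :
    upperShadow A ⊆ monomialsOfDegree σ (d + 1) :=
  upperShadow_subset_iff.2 fun _ hu _ => add_single_mem_monomialsOfDegree.2 (hA hu)

theorem upperShadow_monomialsOfDegree (σ : Type*) [Fintype σ] [DecidableEq σ] (d : ℕ) :
    upperShadow (monomialsOfDegree σ d) = monomialsOfDegree σ (d + 1) := by
  refine (upperShadow_subset_monomialsOfDegree Subset.rfl).antisymm fun u hu => ?_
  obtain ⟨i, -, hi⟩ : ∃ i ∈ univ, u i ≠ 0 := exists_ne_zero_of_sum_ne_zero <| by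
    rw [mem_monomialsOfDegree.1 hu]
    exact d.succ_ne_zero
  rw [← sub_single_add_single hi] at hu ⊢
  exact add_single_mem_upperShadow (add_single_mem_monomialsOfDegree.1 hu) i

theorem upperShadow_image_add_right (A : Finset (σ → ℕ)) (w : σ → ℕ) :
    upperShadow (A.image (· + w)) = (upperShadow A).image (· + w) := by
  simp only [upperShadow, biUnion_image, image_image, Function.comp_def, add_right_comm _ w]

end Shadow

section DivVar

variable {σ : Type*} [DecidableEq σ] {d : ℕ} {A : Finset (σ → ℕ)} {u : σ → ℕ}

/-- The quotient of a set of monomials by the variable `i`: all `u` such that `xᵢ u` is in `A`. -/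
noncomputable def divVar (i : σ) (A : Finset (σ → ℕ)) : Finset (σ → ℕ) :=
  A.preimage (· + Pi.single i 1) (add_left_injective _).injOn

theorem mem_divVar {i : σ} : u ∈ divVar i A ↔ u + Pi.single i 1 ∈ A :=
  mem_preimage

variable [Fintype σ]

theorem divVar_subset_monomialsOfDegree (hA : A ⊆ monomialsOfDegree σ (d + 1)) (i : σ) :
    divVar i A ⊆ monomialsOfDegree σ d := fun _ hu =>
  add_single_mem_monomialsOfDegree.1 (hA (mem_divVar.1 hu))

theorem subset_divVar_upperShadow (i : σ) (A : Finset (σ → ℕ)) :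
    A ⊆ divVar i (upperShadow A) := fun _ hu => mem_divVar.2 (add_single_mem_upperShadow hu i)

theorem upperShadow_divVar_subset (i : σ) (A : Finset (σ → ℕ)) :
    upperShadow (divVar i A) ⊆ divVar i (upperShadow A) :=
  upperShadow_subset_iff.2 fun u hu j => by
    rw [mem_divVar, add_right_comm]
    exact add_single_mem_upperShadow (mem_divVar.1 hu) j

end DivVar

section AvoidVar

variable {n d : ℕ} {A : Finset (Fin (n + 1) → ℕ)} {i : Fin (n + 1)}

/-- The members of a set of monomials which do not involve the variable `i`, as monomials in the
remaining `n` variables. -/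
noncomputable def avoidVar (i : Fin (n + 1)) (A : Finset (Fin (n + 1) → ℕ)) :
    Finset (Fin n → ℕ) :=
  A.preimage (i.insertNth (α := fun _ => ℕ) 0) (Fin.insertNth_right_injective _).injOn

theorem mem_avoidVar {v : Fin n → ℕ} :
    v ∈ avoidVar i A ↔ (i.insertNth 0 v : Fin (n + 1) → ℕ) ∈ A :=
  mem_preimage

theorem avoidVar_subset_monomialsOfDegree (hA : A ⊆ monomialsOfDegree (Fin (n + 1)) d)
    (i : Fin (n + 1)) : avoidVar i A ⊆ monomialsOfDegree (Fin n) d := fun v hv => by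
  simpa [mem_monomialsOfDegree, Fin.sum_univ_succAbove _ i] using hA (mem_avoidVar.1 hv)

theorem insertNth_zero_removeNth {u : Fin (n + 1) → ℕ} (hu : u i = 0) :
    i.insertNth 0 (i.removeNth u) = u :=
  Fin.insertNth_eq_iff.2 ⟨hu.symm, rfl⟩

theorem insertNth_zero_add_single (i : Fin (n + 1)) (v : Fin n → ℕ) (j : Fin n) :
    i.insertNth 0 (v + Pi.single j 1) =
      (i.insertNth 0 v + Pi.single (i.succAbove j) 1 : Fin (n + 1) → ℕ) := by
  refine Fin.insertNth_eq_iff.2 ⟨by simp, ?_⟩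
  ext l
  simp [Fin.removeNth, Pi.single_apply]

theorem upperShadow_avoidVar (i : Fin (n + 1)) (A : Finset (Fin (n + 1) → ℕ)) :
    upperShadow (avoidVar i A) = avoidVar i (upperShadow A) := by
  refine (upperShadow_subset_iff.2 fun v hv j => mem_avoidVar.2 ?_).antisymm fun v hv => ?_
  · rw [insertNth_zero_add_single]
    exact add_single_mem_upperShadow (mem_avoidVar.1 hv) _
  · obtain ⟨j, u, hu, huv⟩ := mem_upperShadow.1 (mem_avoidVar.1 hv)
    have hui : u i = 0 ∧ i ≠ j := by simpa [Pi.single_apply] using congrFun huv i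
    obtain ⟨j, rfl⟩ := Fin.exists_succAbove_eq hui.2.symm
    rw [← insertNth_zero_removeNth hui.1] at hu huv
    rw [← insertNth_zero_add_single] at huv
    rw [← Fin.insertNth_right_injective (α := fun _ => ℕ) 0 huv]
    exact add_single_mem_upperShadow (mem_avoidVar.2 hu) j

theorem card_avoidVar_add_card_divVar (i : Fin (n + 1)) (A : Finset (Fin (n + 1) → ℕ)) :
    #(avoidVar i A) + #(divVar i A) = #A := by
  classical
  have havoid : ∀ u, u ∈ Set.range (i.insertNth (α := fun _ => ℕ) 0) ↔ u i = 0 :=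
    fun u => ⟨by rintro ⟨v, rfl⟩; simp, fun hu => ⟨_, insertNth_zero_removeNth hu⟩⟩
  have hdiv : ∀ u, u ∈ Set.range (fun v : Fin (n + 1) → ℕ => v + Pi.single i 1) ↔ ¬u i = 0 :=
    fun u => ⟨by rintro ⟨v, rfl⟩; simp, fun hu => ⟨_, sub_single_add_single hu⟩⟩
  simp only [avoidVar, divVar, card_preimage, havoid, hdiv, card_filter_add_card_filter_not]

end AvoidVar

section MergeVar

variable {σ : Type*} [DecidableEq σ] {i j : σ} {u v w : σ → ℕ}

/-- The exponent vector obtained by substituting the variable `j` for the variable `i`. -/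
def mergeVar (i j : σ) (u : σ → ℕ) : σ → ℕ :=
  Function.update u i 0 + Pi.single j (u i)

theorem mergeVar_add (i j : σ) (u v : σ → ℕ) :
    mergeVar i j (u + v) = mergeVar i j u + mergeVar i j v := by
  ext l
  rcases eq_or_ne l i with rfl | hl
  · simp [mergeVar, Pi.single_add]
  · simp [mergeVar, Pi.single_add, hl, add_add_add_comm]

theorem mergeVar_single (h : i ≠ j) (a : ℕ) :
    mergeVar i j (Pi.single i a) = mergeVar i j (Pi.single j a) := by
  simp [mergeVar, h, Pi.single]

theorem sum_mergeVar [Fintype σ] (i j : σ) (u : σ → ℕ) : ∑ l, mergeVar i j u l = ∑ l, u l := by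
  simp [mergeVar, sum_add_distrib, sum_update_of_mem, ← add_sum_erase univ u (mem_univ i),
    sdiff_singleton_eq_erase, add_comm]

theorem apply_le_mergeVar (i j : σ) (u : σ → ℕ) : u i ≤ mergeVar i j u j := by
  simp [mergeVar]

theorem eq_of_mergeVar_eq (h : mergeVar i j u = mergeVar i j v) (hi : u i = v i) : u = v := by
  ext l
  rcases eq_or_ne l i with rfl | hl
  · exact hi
  · simpa [mergeVar, hl, hi] using congrFun h l

theorem exists_mergeVar_eq (h : i ≠ j) (u : σ → ℕ) {a : ℕ} (ha : a ≤ mergeVar i j u j) :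
    ∃ v, v i = a ∧ mergeVar i j v = mergeVar i j u := by
  refine ⟨mergeVar i j u - Pi.single j a + Pi.single i a, by simp [mergeVar, h], ?_⟩
  have hle : Pi.single j a ≤ mergeVar i j u := by
    intro l
    rcases eq_or_ne l j with rfl | hl <;> simp [*]
  rw [mergeVar_add, mergeVar_single h, ← mergeVar_add, tsub_add_cancel_of_le hle]
  simp [mergeVar, h]

end MergeVar

section Compression

variable {σ : Type*} [Fintype σ] [DecidableEq σ] {i j : σ} {d : ℕ} {A : Finset (σ → ℕ)}
  {u w : σ → ℕ}

/-- The members of `A` which become `w` when the variable `j` is substituted for `i`. -/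
def mergeFiber (i j : σ) (A : Finset (σ → ℕ)) (w : σ → ℕ) : Finset (σ → ℕ) :=
  {v ∈ A | mergeVar i j v = w}

theorem mem_mergeFiber : u ∈ mergeFiber i j A w ↔ u ∈ A ∧ mergeVar i j u = w :=
  mem_filter

/-- The compression of a set `A` of monomials of degree `d`: every fiber of `mergeVar i j` is
replaced by the same number of monomials with the lowest exponents of the variable `i`. -/
def compression (i j : σ) (d : ℕ) (A : Finset (σ → ℕ)) : Finset (σ → ℕ) :=
  {u ∈ monomialsOfDegree σ d | u i < #(mergeFiber i j A (mergeVar i j u))}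

theorem mem_compression : u ∈ compression i j d A ↔
    u ∈ monomialsOfDegree σ d ∧ u i < #(mergeFiber i j A (mergeVar i j u)) :=
  mem_filter

theorem compression_subset (i j : σ) (d : ℕ) (A : Finset (σ → ℕ)) :
    compression i j d A ⊆ monomialsOfDegree σ d :=
  filter_subset _ _

theorem injOn_apply_mergeFiber (i j : σ) (A : Finset (σ → ℕ)) (w : σ → ℕ) :
    Set.InjOn (fun u => u i) (mergeFiber i j A w : Set (σ → ℕ)) := fun _ hu _ hv h =>
  eq_of_mergeVar_eq ((mem_mergeFiber.1 hu).2.trans (mem_mergeFiber.1 hv).2.symm) h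

theorem card_mergeFiber_le (i j : σ) (A : Finset (σ → ℕ)) (w : σ → ℕ) :
    #(mergeFiber i j A w) ≤ w j + 1 := by
  rw [← card_range (w j + 1)]
  refine card_le_card_of_injOn (fun u => u i) (fun u hu => ?_) (injOn_apply_mergeFiber i j A w)
  obtain ⟨-, rfl⟩ := mem_mergeFiber.1 hu
  simpa [Nat.lt_succ_iff] using apply_le_mergeVar i j u

theorem card_mergeFiber_compression (hij : i ≠ j) (hA : A ⊆ monomialsOfDegree σ d) (w : σ → ℕ) :
    #(mergeFiber i j (compression i j d A) w) = #(mergeFiber i j A w) := by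
  suffices h : (mergeFiber i j (compression i j d A) w).image (fun u => u i) =
      range #(mergeFiber i j A w) by
    rw [← card_image_of_injOn (injOn_apply_mergeFiber i j _ w), h, card_range]
  refine Subset.antisymm (image_subset_iff.2 fun u hu => ?_) fun a ha => ?_
  · obtain ⟨huC, rfl⟩ := mem_mergeFiber.1 hu
    exact mem_range.2 (mem_compression.1 huC).2
  · rw [mem_range] at ha
    obtain ⟨v, hv⟩ := card_pos.1 (Nat.zero_lt_of_lt ha)
    obtain ⟨hvA, rfl⟩ := mem_mergeFiber.1 hv
    obtain ⟨u, rfl, huv⟩ := exists_mergeVar_eq hij v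
      (Nat.lt_succ_iff.1 (ha.trans_le (card_mergeFiber_le i j A _)))
    have hu : u ∈ monomialsOfDegree σ d := by
      rw [mem_monomialsOfDegree, ← sum_mergeVar i j, huv, sum_mergeVar]
      exact mem_monomialsOfDegree.1 (hA hvA)
    exact mem_image.2 ⟨u, mem_mergeFiber.2 ⟨mem_compression.2 ⟨hu, huv ▸ ha⟩, huv⟩, rfl⟩

theorem sum_comp_mergeVar_compression (hij : i ≠ j) (hA : A ⊆ monomialsOfDegree σ d)
    (f : (σ → ℕ) → ℕ) :
    ∑ u ∈ compression i j d A, f (mergeVar i j u) = ∑ u ∈ A, f (mergeVar i j u) := by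
  have hmap : (compression i j d A).val.map (mergeVar i j) = A.val.map (mergeVar i j) := by
    ext w
    have hcard := card_mergeFiber_compression hij hA w
    simp only [mergeFiber, card_def, filter_val] at hcard
    simpa only [Multiset.count_map, eq_comm] using hcard
  have hsum := congrArg (fun s => (s.map f).sum) hmap
  simp only [Multiset.map_map] at hsum
  exact hsum

theorem card_compression (hij : i ≠ j) (hA : A ⊆ monomialsOfDegree σ d) :
    #(compression i j d A) = #A := by
  simpa using sum_comp_mergeVar_compression hij hA fun _ => 1

theorem image_mergeFiber_subset (A : Finset (σ → ℕ)) (w : σ → ℕ) (l : σ) :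
    (mergeFiber i j A w).image (· + Pi.single l 1) ⊆
      mergeFiber i j (upperShadow A) (w + mergeVar i j (Pi.single l 1)) :=
  image_subset_iff.2 fun v hv => by
    obtain ⟨hvA, rfl⟩ := mem_mergeFiber.1 hv
    exact mem_mergeFiber.2 ⟨add_single_mem_upperShadow hvA l, mergeVar_add ..⟩

theorem card_mergeFiber_le_upperShadow (A : Finset (σ → ℕ)) (w : σ → ℕ) (l : σ) :
    #(mergeFiber i j A w) ≤
      #(mergeFiber i j (upperShadow A) (w + mergeVar i j (Pi.single l 1))) := by
  rw [← card_image_of_injective (mergeFiber i j A w) (add_left_injective (Pi.single l 1))]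
  exact card_le_card (image_mergeFiber_subset A w l)

-- Multiplying the fiber by `xⱼ`, and its member with the largest exponent of `xᵢ` by `xᵢ`, stays
-- within one fiber.
theorem card_mergeFiber_lt_upperShadow (hij : i ≠ j) (h : (mergeFiber i j A w).Nonempty) :
    #(mergeFiber i j A w) <
      #(mergeFiber i j (upperShadow A) (w + mergeVar i j (Pi.single i 1))) := by
  obtain ⟨v, hv, hmax⟩ := exists_max_image _ (fun v => v i) h
  have hnot : v + Pi.single i 1 ∉ (mergeFiber i j A w).image (· + Pi.single j 1) := by
    rintro h
    obtain ⟨y, hy, hyv⟩ := mem_image.1 h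
    have hyi : y i = v i + 1 := by simpa [hij] using congrFun hyv i
    have := hmax y hy
    omega
  rw [← card_image_of_injective (mergeFiber i j A w) (add_left_injective (Pi.single j 1)),
    Nat.lt_iff_add_one_le, ← card_insert_of_notMem hnot]
  refine card_le_card (insert_subset (image_mergeFiber_subset A w i (mem_image_of_mem _ hv)) ?_)
  rw [mergeVar_single hij]
  exact image_mergeFiber_subset A w j

theorem upperShadow_compression_subset (hij : i ≠ j) (A : Finset (σ → ℕ)) :
    upperShadow (compression i j d A) ⊆ compression i j (d + 1) (upperShadow A) :=
  upperShadow_subset_iff.2 fun u hu l => by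
    obtain ⟨hud, hui⟩ := mem_compression.1 hu
    refine mem_compression.2 ⟨add_single_mem_monomialsOfDegree.2 hud, ?_⟩
    rw [mergeVar_add]
    rcases eq_or_ne l i with rfl | hl
    · have := card_mergeFiber_lt_upperShadow hij (card_pos.1 (Nat.zero_lt_of_lt hui))
      simp only [Pi.add_apply, Pi.single_eq_same]
      omega
    · simpa [hl.symm] using hui.trans_le (card_mergeFiber_le_upperShadow A _ l)

theorem card_upperShadow_compression_le (hij : i ≠ j) (hA : A ⊆ monomialsOfDegree σ d) :
    #(upperShadow (compression i j d A)) ≤ #(upperShadow A) :=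
  (card_le_card (upperShadow_compression_subset hij A)).trans_eq
    (card_compression hij (upperShadow_subset_monomialsOfDegree hA))

-- The members of `compression \ A` and of `A \ compression` lie below and above the cardinality of
-- their fiber, which has the same sum over both sets.
theorem sum_apply_compression_lt (hij : i ≠ j) (hA : A ⊆ monomialsOfDegree σ d)
    (hne : compression i j d A ≠ A) : ∑ u ∈ compression i j d A, u i < ∑ u ∈ A, u i := by
  set c : (σ → ℕ) → ℕ := fun u => #(mergeFiber i j A (mergeVar i j u))
  set C := compression i j d A
  have hlow : ∑ u ∈ C \ A, u i < ∑ u ∈ C \ A, c u := by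
    refine sum_lt_sum_of_nonempty ?_ fun u hu => (mem_compression.1 (mem_sdiff.1 hu).1).2
    refine nonempty_iff_ne_empty.2 fun h => hne ?_
    exact eq_of_subset_of_card_le (sdiff_eq_empty_iff_subset.1 h) (card_compression hij hA).ge
  have hhigh : ∑ u ∈ A \ C, c u ≤ ∑ u ∈ A \ C, u i := sum_le_sum fun u hu => by
    obtain ⟨huA, huC⟩ := mem_sdiff.1 hu
    exact not_lt.1 fun hlt => huC (mem_compression.2 ⟨hA huA, hlt⟩)
  have hc : ∑ u ∈ C, c u = ∑ u ∈ A, c u :=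
    sum_comp_mergeVar_compression hij hA fun w => #(mergeFiber i j A w)
  rw [← sum_sdiff_lt_sum_sdiff]
  exact hlow.trans_le ((sum_sdiff_eq_sum_sdiff_iff.2 hc).trans_le hhigh)

theorem upperShadow_divVar_subset_of_compression_eq (hA : A ⊆ monomialsOfDegree σ (d + 1))
    (h : ∀ j, i ≠ j → compression i j (d + 1) A = A) : upperShadow (divVar i A) ⊆ A :=
  upperShadow_subset_iff.2 fun u hu j => by
    have hud := add_single_mem_monomialsOfDegree.1 (hA (mem_divVar.1 hu))
    rcases eq_or_ne i j with rfl | hij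
    · exact mem_divVar.1 hu
    · have hu := (mem_compression.1 ((h j hij).symm ▸ mem_divVar.1 hu)).2
      rw [← h j hij]
      refine mem_compression.2 ⟨add_single_mem_monomialsOfDegree.2 hud, ?_⟩
      rw [mergeVar_add, ← mergeVar_single hij, ← mergeVar_add]
      exact lt_of_le_of_lt (by simp [hij]) hu

theorem exists_upperShadow_divVar_subset (i : σ) (hA : A ⊆ monomialsOfDegree σ (d + 1)) :
    ∃ B ⊆ monomialsOfDegree σ (d + 1), #B = #A ∧ #(upperShadow B) ≤ #(upperShadow A) ∧
      upperShadow (divVar i B) ⊆ B := by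
  induction hm : ∑ u ∈ A, u i using Nat.strong_induction_on generalizing A with
  | _ m ih =>
    by_cases h : ∀ j, i ≠ j → compression i j (d + 1) A = A
    · exact ⟨A, hA, rfl, le_rfl, upperShadow_divVar_subset_of_compression_eq hA h⟩
    · push Not at h
      obtain ⟨j, hij, hne⟩ := h
      obtain ⟨B, hB, hcard, hshadow, hstable⟩ := ih _ (hm ▸ sum_apply_compression_lt hij hA hne)
        (compression_subset i j _ A) rfl
      exact ⟨B, hB, hcard.trans (card_compression hij hA),
        hshadow.trans (card_upperShadow_compression_le hij hA), hstable⟩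

end Compression

/-- A lex segment of degree `d`: a set of monomials of degree `d` which contains, with each of its
members, all lexicographically larger monomials of degree `d`, for `x₀ > x₁ > ⋯`. -/
structure IsLexSegment {n : ℕ} (d : ℕ) (L : Finset (Fin n → ℕ)) : Prop where
  subset : L ⊆ monomialsOfDegree (Fin n) d
  mem_of_le : ∀ ⦃u⦄, u ∈ L → ∀ ⦃v⦄, v ∈ monomialsOfDegree (Fin n) d → toLex u ≤ toLex v → v ∈ L

theorem toLex_insertNth_zero_le {n : ℕ} (i : Fin (n + 1)) {v w : Fin n → ℕ}
    (h : toLex v ≤ toLex w) :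
    toLex (i.insertNth 0 v : Fin (n + 1) → ℕ) ≤ toLex (i.insertNth 0 w : Fin (n + 1) → ℕ) := by
  rcases h.eq_or_lt with h | ⟨m, hlt, hm⟩
  · exact (congrArg (fun u : Fin n → ℕ => toLex (i.insertNth 0 u : Fin (n + 1) → ℕ))
      (toLex.injective h)).le
  · refine le_of_lt ⟨i.succAbove m, fun l hl => ?_, by simpa using hm⟩
    rcases Fin.eq_self_or_eq_succAbove i l with rfl | ⟨l, rfl⟩
    · simp
    · simpa using hlt l ((Fin.strictMono_succAbove i).lt_iff_lt.1 hl)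

theorem toLex_single_last_le {n : ℕ} (i : Fin (n + 1)) :
    toLex (Pi.single (Fin.last n) 1 : Fin (n + 1) → ℕ) ≤ toLex (Pi.single i 1) := by
  rcases (Fin.le_last i).eq_or_lt with rfl | hi
  · exact le_rfl
  · exact le_of_lt ⟨i, fun l hl => by simp [hl.ne, (hl.trans hi).ne], by simp [hi.ne]⟩

-- If `v / xⱼ < u`, consider the first variable where these differ: if it precedes `xⱼ` then
-- `v < u`, and otherwise `v / xⱼ` properly divides `u`.
theorem toLex_le_sub_single {n : ℕ} {u v : Fin n → ℕ} {j : Fin n} (hj : v j ≠ 0)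
    (hlast : ∀ l, j < l → v l = 0) (hle : toLex u ≤ toLex v) (hsum : ∑ l, v l = ∑ l, u l + 1) :
    toLex u ≤ toLex (v - Pi.single j 1) := by
  by_contra! hlt
  obtain ⟨m, heq, hm⟩ := hlt
  simp only [Pi.toLex_apply] at heq hm
  rcases lt_or_ge m j with hmj | hjm
  · refine hle.not_gt ⟨m, fun l hl => ?_, ?_⟩
    · simpa [(hl.trans hmj).ne] using heq l hl
    · simpa [hmj.ne] using hm
  · have hdvd : ∀ l, (v - Pi.single j 1 : Fin n → ℕ) l ≤ u l := fun l => by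
      rcases lt_trichotomy l m with hl | rfl | hl
      · exact (heq l hl).le
      · exact hm.le
      · simp [hlast l (hjm.trans_lt hl)]
    have hlt := sum_lt_sum (fun l _ => hdvd l) ⟨m, mem_univ m, hm⟩
    rw [← sub_single_add_single hj] at hsum
    simp only [Pi.add_apply, sum_add_distrib, sum_pi_single', mem_univ, if_true] at hsum
    omega

namespace IsLexSegment

variable {n d : ℕ} {L M A : Finset (Fin n → ℕ)}

theorem subset_total (hL : IsLexSegment d L) (hM : IsLexSegment d M) : L ⊆ M ∨ M ⊆ L := by
  by_contra! h
  obtain ⟨⟨u, huL, huM⟩, ⟨v, hvM, hvL⟩⟩ := h.imp not_subset.1 not_subset.1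
  rcases le_total (toLex u) (toLex v) with h | h
  · exact hvL (hL.mem_of_le huL (hM.subset hvM) h)
  · exact huM (hM.mem_of_le hvM (hL.subset huL) h)

theorem subset_of_card_le (hL : IsLexSegment d L) (hM : IsLexSegment d M) (h : #L ≤ #M) :
    L ⊆ M :=
  (hL.subset_total hM).elim id fun hML => (eq_of_subset_of_card_le hML h).ge

protected theorem upperShadow (hL : IsLexSegment d L) : IsLexSegment (d + 1) (upperShadow L) where
  subset := upperShadow_subset_monomialsOfDegree hL.subset
  mem_of_le := by
    intro w hw v hv hle
    obtain ⟨i, u, hu, rfl⟩ := mem_upperShadow.1 hw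
    have hsupp : ({l | v l ≠ 0} : Finset (Fin n)).Nonempty := by
      obtain ⟨l, hl⟩ := exists_ne_zero_of_sum_ne_zero
        ((mem_monomialsOfDegree.1 hv).trans_ne d.succ_ne_zero)
      exact ⟨l, by simpa using hl⟩
    set j := max' _ hsupp
    have hj : v j ≠ 0 := by simpa using max'_mem _ hsupp
    have hlast : ∀ l, j < l → v l = 0 := fun l hl => by
      by_contra hvl
      exact hl.not_ge (le_max' _ _ (by simpa using hvl))
    have hv' : v - Pi.single j 1 ∈ monomialsOfDegree (Fin n) d := by
      rwa [← add_single_mem_monomialsOfDegree, sub_single_add_single hj]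
    rw [← sub_single_add_single hj]
    refine add_single_mem_upperShadow (hL.mem_of_le hu hv' (toLex_le_sub_single hj hlast ?_ ?_)) j
    · exact le_trans (Pi.toLex_monotone (by simp)) hle
    · rw [mem_monomialsOfDegree.1 hv, mem_monomialsOfDegree.1 (hL.subset hu)]

protected theorem divVar {L : Finset (Fin n → ℕ)} (hL : IsLexSegment (d + 1) L) (i : Fin n) :
    IsLexSegment d (divVar i L) where
  subset := divVar_subset_monomialsOfDegree hL.subset i
  mem_of_le _ hu _ hv hle := mem_divVar.2 <| hL.mem_of_le (mem_divVar.1 hu)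
    (add_single_mem_monomialsOfDegree.2 hv) (by simpa using hle)

protected theorem avoidVar {L : Finset (Fin (n + 1) → ℕ)} (hL : IsLexSegment d L)
    (i : Fin (n + 1)) : IsLexSegment d (avoidVar i L) where
  subset := avoidVar_subset_monomialsOfDegree hL.subset i
  mem_of_le u hu v hv hle := mem_avoidVar.2 <| hL.mem_of_le (mem_avoidVar.1 hu)
    (by simpa [mem_monomialsOfDegree, Fin.sum_univ_succAbove _ i] using hv)
    (toLex_insertNth_zero_le i hle)

end IsLexSegment

theorem divVar_last_upperShadow_subset {n d : ℕ} {L : Finset (Fin (n + 1) → ℕ)}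
    (hL : IsLexSegment d L) : divVar (Fin.last n) (upperShadow L) ⊆ L := fun v hv => by
  obtain ⟨i, u, hu, huv⟩ := mem_upperShadow.1 (mem_divVar.1 hv)
  have hvd := divVar_subset_monomialsOfDegree (upperShadow_subset_monomialsOfDegree hL.subset) _ hv
  refine hL.mem_of_le hu hvd (le_of_add_le_add_right (a := toLex (Pi.single (Fin.last n) 1)) ?_)
  exact (add_le_add_right (toLex_single_last_le i) _).trans_eq (congrArg toLex huv)

theorem card_upperShadow_avoidVar_add_card_le {n : ℕ} (i : Fin (n + 1))
    (A : Finset (Fin (n + 1) → ℕ)) : #(upperShadow (avoidVar i A)) + #A ≤ #(upperShadow A) := by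
  rw [upperShadow_avoidVar, ← card_avoidVar_add_card_divVar i (upperShadow A)]
  exact Nat.add_le_add_left (card_le_card (subset_divVar_upperShadow i A)) _

theorem IsLexSegment.card_upperShadow_eq {n d : ℕ} {L : Finset (Fin (n + 1) → ℕ)}
    (hL : IsLexSegment d L) :
    #(upperShadow L) = #(upperShadow (avoidVar (Fin.last n) L)) + #L := by
  rw [upperShadow_avoidVar, ← card_avoidVar_add_card_divVar (Fin.last n) (upperShadow L),
    (divVar_last_upperShadow_subset hL).antisymm (subset_divVar_upperShadow _ L)]

theorem exists_isLexSegment_card_eq {n d s : ℕ} (hs : s ≤ n.multichoose d) :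
    ∃ L : Finset (Fin n → ℕ), IsLexSegment d L ∧ #L = s := by
  induction s with
  | zero => exact ⟨∅, ⟨by simp, by simp⟩, rfl⟩
  | succ s ih =>
    obtain ⟨L, hL, rfl⟩ := ih (by omega)
    have hne : (monomialsOfDegree (Fin n) d \ L).Nonempty := by
      rw [← card_pos, card_sdiff_of_subset hL.subset, card_monomialsOfDegree, Fintype.card_fin]
      omega
    obtain ⟨u, hu, hmax⟩ := exists_max_image _ toLex hne
    obtain ⟨hud, huL⟩ := mem_sdiff.1 hu
    refine ⟨insert u L, ⟨insert_subset hud hL.subset, fun w hw v hv hle => ?_⟩,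
      card_insert_of_notMem huL⟩
    by_contra hv'
    obtain ⟨hvu, hvL⟩ : v ≠ u ∧ v ∉ L := by simpa using hv'
    rcases mem_insert.1 hw with rfl | hwL
    · exact hvu (toLex.injective (hle.antisymm' (hmax v (mem_sdiff.2 ⟨hv, hvL⟩))))
    · exact hvL (hL.mem_of_le hwL hv hle)

theorem isLexSegment_zero {n : ℕ} {A : Finset (Fin n → ℕ)}
    (hA : A ⊆ monomialsOfDegree (Fin n) 0) : IsLexSegment 0 A where
  subset := hA
  mem_of_le u hu v hv _ := by
    have hu0 : ∀ l, u l = 0 := by simpa [mem_monomialsOfDegree] using hA hu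
    have hv0 : ∀ l, v l = 0 := by simpa [mem_monomialsOfDegree] using hv
    rwa [show v = u from funext fun l => (hv0 l).trans (hu0 l).symm]

-- After `A` is replaced by a stable set of the same cardinality, it contains the shadow of its
-- quotient by the last variable, so that this quotient is not larger than that of `L`.
theorem card_upperShadow_le_of_isLexSegment {n d : ℕ} {L A : Finset (Fin n → ℕ)}
    (hL : IsLexSegment d L) (hA : A ⊆ monomialsOfDegree (Fin n) d) (hcard : #L ≤ #A) :
    #(upperShadow L) ≤ #(upperShadow A) := by
  induction n generalizing d with
  | zero => simp [upperShadow]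
  | succ n ihn =>
    induction d generalizing L A with
    | zero =>
      exact card_le_card (upperShadow_mono (hL.subset_of_card_le (isLexSegment_zero hA) hcard))
    | succ d ihd =>
      obtain ⟨A', hA', hcardA'⟩ := exists_subset_card_eq hcard
      obtain ⟨B, hB, hcardB, hshadowB, hstable⟩ :=
        exists_upperShadow_divVar_subset (Fin.last n) (hA'.trans hA)
      refine le_trans ?_ (hshadowB.trans (card_le_card (upperShadow_mono hA')))
      have hBL : #B = #L := hcardB.trans hcardA'
      have hdivB := divVar_subset_monomialsOfDegree hB (Fin.last n)
      obtain ⟨M, hM, hcardM⟩ := exists_isLexSegment_card_eq (n := n + 1) (d := d)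
        (s := #(divVar (Fin.last n) B)) <| by
          simpa [card_monomialsOfDegree] using card_le_card hdivB
      have hshadowM : upperShadow M ⊆ L := hM.upperShadow.subset_of_card_le hL <|
        (ihd hM hdivB hcardM.le).trans ((card_le_card hstable).trans hBL.le)
      have hdiv : #(divVar (Fin.last n) B) ≤ #(divVar (Fin.last n) L) :=
        hcardM.ge.trans <| card_le_card fun u hu =>
          mem_divVar.2 (hshadowM (add_single_mem_upperShadow hu _))
      have havoid : #(avoidVar (Fin.last n) L) ≤ #(avoidVar (Fin.last n) B) := by
        have := card_avoidVar_add_card_divVar (Fin.last n) L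
        have := card_avoidVar_add_card_divVar (Fin.last n) B
        omega
      calc #(upperShadow L)
          = #(upperShadow (avoidVar (Fin.last n) L)) + #L := hL.card_upperShadow_eq
        _ ≤ #(upperShadow (avoidVar (Fin.last n) B)) + #B :=
            add_le_add (ihn (hL.avoidVar _) (avoidVar_subset_monomialsOfDegree hB _) havoid) hBL.ge
        _ ≤ #(upperShadow B) := card_upperShadow_avoidVar_add_card_le _ B

theorem sum_choose_lt_choose {p m : ℕ} {t : Fin p → ℕ} (ht : StrictMono t) (hm : ∀ j, t j < m) :
    ∑ j : Fin p, (t j).choose (j + 1) < m.choose p := by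
  induction p generalizing m with
  | zero => simp
  | succ p ih =>
    have hinit := ih (ht.comp Fin.strictMono_castSucc) fun j => ht (Fin.castSucc_lt_last j)
    calc ∑ j : Fin (p + 1), (t j).choose (j + 1)
        = (∑ j : Fin p, (t j.castSucc).choose (j + 1)) + (t (Fin.last p)).choose (p + 1) :=
          Fin.sum_univ_castSucc _
      _ < (t (Fin.last p)).choose p + (t (Fin.last p)).choose (p + 1) :=
          Nat.add_lt_add_right hinit _
      _ = (t (Fin.last p) + 1).choose (p + 1) := (Nat.choose_succ_succ' _ _).symm
      _ ≤ m.choose (p + 1) := Nat.choose_le_choose _ (hm _)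

theorem strictMono_snoc {p m : ℕ} {t : Fin p → ℕ} (ht : StrictMono t) (hm : ∀ j, t j < m) :
    StrictMono (Fin.snoc t m : Fin (p + 1) → ℕ) := by
  intro i j hij
  obtain ⟨i, rfl⟩ := Fin.exists_castSucc_eq.2 ((hij.trans_le (Fin.le_last j)).ne)
  induction j using Fin.lastCases with
  | last => simpa using hm i
  | cast j => simpa using ht (Fin.castSucc_lt_castSucc_iff.1 hij)

theorem exists_isMacaulayRep_lt {p m s : ℕ} (h : s < m.choose p) :
    ∃ t, IsMacaulayRep p s t ∧ ∀ j, t j < m := by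
  induction m generalizing p s with
  | zero =>
    cases p with
    | zero => exact ⟨Fin.elim0, ⟨fun i => i.elim0, by simpa using h⟩, fun i => i.elim0⟩
    | succ p => simp at h
  | succ m ih =>
    cases p with
    | zero => exact ⟨Fin.elim0, ⟨fun i => i.elim0, by simpa using h⟩, fun i => i.elim0⟩
    | succ p =>
      rcases lt_or_ge s (m.choose (p + 1)) with hs | hs
      · obtain ⟨t, ht, hm⟩ := ih hs
        exact ⟨t, ht, fun j => (hm j).trans m.lt_succ_self⟩
      · rw [Nat.choose_succ_succ'] at h
        obtain ⟨t, ⟨ht, hsum⟩, hm⟩ := ih (p := p) (s := s - m.choose (p + 1)) (by omega)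
        refine ⟨Fin.snoc (α := fun _ => ℕ) t m, ⟨strictMono_snoc ht hm, ?_⟩,
          Fin.lastCases (by simp) fun j => by simpa using (hm j).trans m.lt_succ_self⟩
        simp only [Fin.sum_univ_castSucc, Fin.snoc_castSucc, Fin.snoc_last, Fin.val_castSucc,
          Fin.val_last, ← hsum]
        omega

namespace IsMacaulayRep

variable {p s m : ℕ}

theorem init {t : Fin (p + 1) → ℕ} (ht : IsMacaulayRep (p + 1) s t) :
    IsMacaulayRep p (s - (t (Fin.last p)).choose (p + 1)) fun j => t j.castSucc := by
  refine ⟨ht.1.comp Fin.strictMono_castSucc, ?_⟩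
  rw [ht.2, Fin.sum_univ_castSucc]
  simp

theorem le_last {t : Fin (p + 1) → ℕ} (ht : IsMacaulayRep (p + 1) s t)
    (h : m.choose (p + 1) ≤ s) : m ≤ t (Fin.last p) := by
  by_contra! hlt
  refine h.not_gt (ht.2.trans_lt ?_)
  exact sum_choose_lt_choose ht.1 fun j => (ht.1.monotone (Fin.le_last j)).trans_lt hlt

theorem choose_last_le {t : Fin (p + 1) → ℕ} (ht : IsMacaulayRep (p + 1) s t) :
    (t (Fin.last p)).choose (p + 1) ≤ s := by
  rw [ht.2, Fin.sum_univ_castSucc]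
  exact Nat.le_add_left _ _

theorem last_lt {t : Fin (p + 1) → ℕ} (ht : IsMacaulayRep (p + 1) s t)
    (h : s < m.choose (p + 1)) : t (Fin.last p) < m := by
  by_contra! hle
  exact h.not_ge ((Nat.choose_le_choose _ hle).trans ht.choose_last_le)

theorem unique {t u : Fin p → ℕ} (ht : IsMacaulayRep p s t) (hu : IsMacaulayRep p s u) :
    t = u := by
  induction p generalizing s with
  | zero => exact Subsingleton.elim _ _
  | succ p ih =>
    have hlast := (hu.le_last ht.choose_last_le).antisymm (ht.le_last hu.choose_last_le)
    have hinit := ih (hlast ▸ ht.init) hu.init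
    exact funext (Fin.lastCases hlast (congrFun hinit))

end IsMacaulayRep

theorem lt_choose_add_succ (s p : ℕ) : s < (s + p + 1).choose (p + 1) := by
  induction p with
  | zero => simp
  | succ p ih =>
    rw [Nat.choose_succ_succ']
    exact ih.trans_le (Nat.le_add_right _ _)

theorem existsUnique_isMacaulayRep {p : ℕ} (hp : p ≠ 0) (s : ℕ) :
    ∃! t, IsMacaulayRep p s t := by
  obtain ⟨p, rfl⟩ := Nat.exists_eq_succ_of_ne_zero hp
  obtain ⟨t, ht, -⟩ := exists_isMacaulayRep_lt (lt_choose_add_succ s p)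
  exact ⟨t, ht, fun u hu => hu.unique ht⟩

theorem IsLexSegment.image_add_single_zero {n d : ℕ} {L : Finset (Fin (n + 1) → ℕ)}
    (hL : IsLexSegment d L) : IsLexSegment (d + 1) (L.image (· + Pi.single 0 1)) where
  subset := image_subset_iff.2 fun _ hu => add_single_mem_monomialsOfDegree.2 (hL.subset hu)
  mem_of_le w hw v hv hle := by
    obtain ⟨u, hu, rfl⟩ := mem_image.1 hw
    have hle0 : (u + Pi.single 0 1 : Fin (n + 1) → ℕ) 0 ≤ v 0 := by
      rcases hle.eq_or_lt with h | ⟨i, heq, hlt⟩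
      · exact (congrFun (toLex.injective h) 0).le
      · rcases (Fin.zero_le i).eq_or_lt with rfl | hi
        · exact hlt.le
        · exact (heq 0 hi).le
    have hv0 : v 0 ≠ 0 := by
      rw [Pi.add_apply, Pi.single_eq_same] at hle0
      omega
    rw [← sub_single_add_single hv0] at hv hle ⊢
    refine mem_image_of_mem _ (hL.mem_of_le hu (add_single_mem_monomialsOfDegree.1 hv) ?_)
    exact le_of_add_le_add_right (a := toLex (Pi.single 0 1)) hle

theorem isLexSegment_monomialsOfDegree (n d : ℕ) :
    IsLexSegment d (monomialsOfDegree (Fin n) d) where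
  subset := Subset.rfl
  mem_of_le _ _ _ hv _ := hv

section FirstVariable

variable {n d : ℕ} {L : Finset (Fin (n + 1) → ℕ)}

theorem card_image_add_single_monomialsOfDegree (i : Fin n) (d : ℕ) :
    #((monomialsOfDegree (Fin n) d).image (· + Pi.single i 1)) = n.multichoose d := by
  rw [card_image_of_injective _ (add_left_injective _), card_monomialsOfDegree, Fintype.card_fin]

-- The monomials divisible by `x₀` are the lexicographically largest ones.
theorem IsLexSegment.avoidVar_zero_eq_empty (hL : IsLexSegment (d + 1) L)
    (hcard : #L ≤ (n + 1).multichoose d) : avoidVar 0 L = ∅ := by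
  rw [← card_image_add_single_monomialsOfDegree 0] at hcard
  have hsub := hL.subset_of_card_le
    (isLexSegment_monomialsOfDegree (n + 1) d).image_add_single_zero hcard
  refine eq_empty_of_forall_notMem fun v hv => ?_
  obtain ⟨u, -, hu⟩ := mem_image.1 (hsub (mem_avoidVar.1 hv))
  simpa using congrFun hu 0

theorem IsLexSegment.divVar_zero_eq_monomialsOfDegree (hL : IsLexSegment (d + 1) L)
    (hcard : (n + 1).multichoose d ≤ #L) :
    divVar 0 L = monomialsOfDegree (Fin (n + 1)) d := by
  rw [← card_image_add_single_monomialsOfDegree 0] at hcard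
  have hsub := (isLexSegment_monomialsOfDegree (n + 1) d).image_add_single_zero.subset_of_card_le
    hL hcard
  exact (divVar_subset_monomialsOfDegree hL.subset 0).antisymm fun u hu =>
    mem_divVar.2 (hsub (mem_image_of_mem _ hu))

theorem card_upperShadow_avoidVar_add_card_upperShadow_divVar_le (i : Fin (n + 1))
    (A : Finset (Fin (n + 1) → ℕ)) :
    #(upperShadow (avoidVar i A)) + #(upperShadow (divVar i A)) ≤ #(upperShadow A) := by
  rw [upperShadow_avoidVar, ← card_avoidVar_add_card_divVar i (upperShadow A)]
  exact Nat.add_le_add_left (card_le_card (upperShadow_divVar_subset i A)) _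

theorem card_upperShadow_divVar_le (i : Fin (n + 1)) (A : Finset (Fin (n + 1) → ℕ)) :
    #(upperShadow (divVar i A)) ≤ #(upperShadow A) :=
  (Nat.le_add_left _ _).trans (card_upperShadow_avoidVar_add_card_upperShadow_divVar_le i A)

theorem IsLexSegment.card_upperShadow_avoidVar_zero_add_le (hL : IsLexSegment (d + 1) L)
    (hcard : (n + 1).multichoose d ≤ #L) :
    #(upperShadow (avoidVar 0 L)) + (n + 1).multichoose (d + 1) ≤
      #(upperShadow L) := by
  have hfull : #(upperShadow (divVar 0 L)) = (n + 1).multichoose (d + 1) := by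
    rw [hL.divVar_zero_eq_monomialsOfDegree hcard, upperShadow_monomialsOfDegree,
      card_monomialsOfDegree, Fintype.card_fin]
  rw [← hfull]
  exact card_upperShadow_avoidVar_add_card_upperShadow_divVar_le 0 L

theorem IsLexSegment.card_divVar_zero_eq (hL : IsLexSegment (d + 1) L)
    (hcard : #L ≤ (n + 1).multichoose d) : #(divVar 0 L) = #L := by
  simpa [hL.avoidVar_zero_eq_empty hcard] using card_avoidVar_add_card_divVar 0 L

theorem IsLexSegment.card_avoidVar_zero_add (hL : IsLexSegment (d + 1) L)
    (hcard : (n + 1).multichoose d ≤ #L) :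
    #(avoidVar 0 L) + (n + 1).multichoose d = #L := by
  rw [← card_avoidVar_add_card_divVar 0 L, hL.divVar_zero_eq_monomialsOfDegree hcard,
    card_monomialsOfDegree, Fintype.card_fin]

end FirstVariable

theorem multichoose_succ_eq_choose_add (p d : ℕ) : (p + 1).multichoose d = (p + d).choose p := by
  rw [Nat.multichoose_eq, add_right_comm, Nat.add_sub_cancel, Nat.choose_symm_add]

theorem multichoose_succ_right_eq_choose (n q : ℕ) :
    n.multichoose (q + 1) = (n + q).choose (q + 1) := by
  rw [Nat.multichoose_eq, ← add_assoc, Nat.add_sub_cancel]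

theorem multichoose_lt_multichoose_succ (p d : ℕ) :
    (p + 2).multichoose d < (p + 2).multichoose (d + 1) := by
  rw [Nat.multichoose_succ_succ, multichoose_succ_eq_choose_add p (d + 1)]
  exact Nat.lt_add_of_pos_left (Nat.choose_pos (Nat.le_add_right _ _))

theorem IsLexSegment.sum_choose_le_card_upperShadow {p d : ℕ} {L : Finset (Fin (p + 1) → ℕ)}
    {t : Fin p → ℕ} (hL : IsLexSegment d L) (ht : IsMacaulayRep p #L t)
    (hcard : #L < (p + 1).multichoose d) :
    ∑ j, (if j + 1 ≤ t j then (t j + 1).choose (j + 1) else 0) ≤ #(upperShadow L) := by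
  induction p generalizing d with
  | zero => simp
  | succ p ihp =>
    induction d generalizing L with
    | zero =>
      rw [Nat.multichoose_zero_right, Nat.lt_one_iff] at hcard
      have hvanish : ∀ j : Fin (p + 1), ¬ (j + 1 ≤ t j) := by
        simpa [hcard, IsMacaulayRep, Nat.choose_eq_zero_iff, sum_eq_zero_iff,
          eq_comm (a := 0)] using ht.2
      simp [hvanish]
    | succ d ihd =>
      rcases lt_or_ge #L ((p + 2).multichoose d) with hlt | hge
      · have hdiv := hL.card_divVar_zero_eq hlt.le
        exact (ihd (hL.divVar 0) (hdiv ▸ ht) (hdiv ▸ hlt)).trans (card_upperShadow_divVar_le 0 L)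
      · have hlast : t (Fin.last p) = p + 1 + d := by
          refine (Nat.lt_add_one_iff.1 (ht.last_lt ?_)).antisymm (ht.le_last ?_)
          · rwa [add_assoc (p + 1) d 1, ← multichoose_succ_eq_choose_add]
          · rwa [← multichoose_succ_eq_choose_add]
        have havoid := hL.card_avoidVar_zero_add hge
        have hrep := ht.init
        rw [hlast, ← multichoose_succ_eq_choose_add, ← havoid, Nat.add_sub_cancel] at hrep
        rw [Nat.multichoose_succ_succ, ← havoid, add_lt_add_iff_right] at hcard
        have hinit := ihp (hL.avoidVar 0) hrep hcard
        rw [Fin.sum_univ_castSucc]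
        refine le_trans (Nat.add_le_add hinit ?_) (hL.card_upperShadow_avoidVar_zero_add_le hge)
        rw [Fin.val_last, hlast, if_pos (by omega), multichoose_succ_eq_choose_add, add_assoc]

theorem IsLexSegment.multichoose_le_card_upperShadow_add {n q s : ℕ} {L : Finset (Fin n → ℕ)}
    {t : Fin q → ℕ} (hL : IsLexSegment q L) (ht : IsMacaulayRep q s t)
    (hcard : #L + s = n.multichoose q) :
    n.multichoose (q + 1) ≤ #(upperShadow L) + ∑ j, (t j + 1).choose (j + 1 + 1) := by
  induction q generalizing n s with
  | zero =>
    have hs : s = 0 := by simpa using ht.2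
    have hfull : L = monomialsOfDegree (Fin n) 0 := eq_of_subset_of_card_le hL.subset <| by
      simp [card_monomialsOfDegree, ← hcard, hs]
    simp [hfull, upperShadow_monomialsOfDegree, card_monomialsOfDegree]
  | succ q ihq =>
    induction n generalizing s with
    | zero => simp
    | succ n ihn =>
      have hpascal := Nat.multichoose_succ_succ n q
      have hpascal' := Nat.multichoose_succ_succ n (q + 1)
      rcases le_or_gt ((n + 1).multichoose q) #L with hge | hlt
      · have havoid := hL.card_avoidVar_zero_add hge
        have hrec := ihn (hL.avoidVar 0) ht (by omega)
        have hshadow := hL.card_upperShadow_avoidVar_zero_add_le hge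
        omega
      · have hlast : n + q ≤ t (Fin.last q) := ht.le_last <| by
          rw [← multichoose_succ_right_eq_choose]
          omega
        rw [Fin.sum_univ_castSucc, Fin.val_last]
        rcases hlast.eq_or_lt with heq | hgt
        · have hdiv := hL.card_divVar_zero_eq hlt.le
          have hrep := ht.init
          rw [← heq, ← multichoose_succ_right_eq_choose] at hrep
          have hrec := ihq (hL.divVar 0) hrep (by omega)
          have hshadow := card_upperShadow_divVar_le 0 L
          rw [← heq, add_assoc n q 1, ← multichoose_succ_right_eq_choose]
          simp only [Fin.val_castSucc] at hrec ⊢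
          omega
        · calc (n + 1).multichoose (q + 1 + 1)
              = (n + q + 1 + 1).choose (q + 1 + 1) := by
                rw [multichoose_succ_right_eq_choose, ← add_assoc, add_right_comm n 1 q]
            _ ≤ (t (Fin.last q) + 1).choose (q + 1 + 1) :=
                Nat.choose_le_choose _ (Nat.succ_le_succ hgt)
            _ ≤ _ := (Nat.le_add_left _ _).trans (Nat.le_add_left _ _)

theorem exists_isLexSegment_card_upperShadow_le {n d : ℕ} {A : Finset (Fin n → ℕ)}
    (hA : A ⊆ monomialsOfDegree (Fin n) d) :
    ∃ L : Finset (Fin n → ℕ), IsLexSegment d L ∧ #L = #A ∧ #(upperShadow L) ≤ #(upperShadow A) := by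
  obtain ⟨L, hL, hcard⟩ := exists_isLexSegment_card_eq (n := n) (d := d) (s := #A) <| by
    simpa [card_monomialsOfDegree] using card_le_card hA
  exact ⟨L, hL, hcard, card_upperShadow_le_of_isLexSegment hL hA hcard.le⟩

theorem multichoose_le_card_upperShadow_add {n q s : ℕ} {A : Finset (Fin n → ℕ)} {t : Fin q → ℕ}
    (hA : A ⊆ monomialsOfDegree (Fin n) q) (ht : IsMacaulayRep q s t)
    (hcard : #A + s = n.multichoose q) :
    n.multichoose (q + 1) ≤ #(upperShadow A) + ∑ j, (t j + 1).choose (j + 1 + 1) := by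
  obtain ⟨L, hL, hLA, hshadow⟩ := exists_isLexSegment_card_upperShadow_le hA
  exact (hL.multichoose_le_card_upperShadow_add ht (hLA ▸ hcard)).trans
    (Nat.add_le_add_right hshadow _)

-- The set is replaced by its product with `x₀`, which has the same shadow up to that factor and is
-- not the whole of the next degree.
theorem sum_choose_le_card_upperShadow {p d : ℕ} {A : Finset (Fin (p + 1) → ℕ)} {t : Fin p → ℕ}
    (hA : A ⊆ monomialsOfDegree (Fin (p + 1)) d) (ht : IsMacaulayRep p #A t) :
    ∑ j, (if j + 1 ≤ t j then (t j + 1).choose (j + 1) else 0) ≤ #(upperShadow A) := by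
  cases p with
  | zero => simp
  | succ p =>
    have hinj : Function.Injective (· + Pi.single 0 1 : (Fin (p + 2) → ℕ) → Fin (p + 2) → ℕ) :=
      add_left_injective _
    have hA' : A.image (· + Pi.single 0 1) ⊆ monomialsOfDegree (Fin (p + 2)) (d + 1) :=
      image_subset_iff.2 fun _ hu => add_single_mem_monomialsOfDegree.2 (hA hu)
    obtain ⟨L, hL, hLA, hshadow⟩ := exists_isLexSegment_card_upperShadow_le hA'
    rw [upperShadow_image_add_right, card_image_of_injective _ hinj] at hshadow
    rw [card_image_of_injective _ hinj] at hLA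
    have hAd : #A ≤ (p + 2).multichoose d := by
      simpa [card_monomialsOfDegree] using card_le_card hA
    have hlt := hAd.trans_lt (multichoose_lt_multichoose_succ p d)
    exact (hL.sum_choose_le_card_upperShadow (hLA ▸ ht) (hLA ▸ hlt)).trans hshadow

section LeadingExponents

open MvPolynomial

theorem linearIndependent_of_injective_degree {σ R ι : Type*} [CommRing R] [NoZeroDivisors R]
    (m : MonomialOrder σ) {f : ι → MvPolynomial σ R} (hf : ∀ i, f i ≠ 0)
    (hinj : Function.Injective fun i => m.degree (f i)) : LinearIndependent R f := by
  classical
  rw [linearIndependent_iff']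
  intro s g hg
  by_contra! hne
  obtain ⟨i, hi, hmax⟩ := exists_max_image {i ∈ s | g i ≠ 0} (fun i => m.toSyn (m.degree (f i)))
    (filter_nonempty_iff.2 hne)
  obtain ⟨his, hgi⟩ := mem_filter.1 hi
  have hcoeff : ∑ j ∈ s, g j * coeff (m.degree (f i)) (f j) = 0 := by
    simpa [coeff_sum] using congrArg (coeff (m.degree (f i))) hg
  rw [sum_eq_single_of_mem i his fun j hj hji => ?_] at hcoeff
  · exact mul_ne_zero hgi (m.coeff_degree_ne_zero_iff.2 (hf i)) hcoeff
  · by_cases hgj : g j = 0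
    · rw [hgj, zero_mul]
    · have hlt := (hmax j (mem_filter.2 ⟨hj, hgj⟩)).lt_of_ne fun h =>
        hji (hinj (m.toSyn.injective h))
      rw [m.coeff_eq_zero_of_lt hlt, mul_zero]

theorem finite_of_le_homogeneousSubmodule {σ R : Type*} [Finite σ] [CommRing R]
    [IsNoetherianRing R] {d : ℕ} {V : Submodule R (MvPolynomial σ R)}
    (hV : V ≤ homogeneousSubmodule σ R d) : Module.Finite R V := by
  have : Module.Finite R (homogeneousSubmodule σ R d) :=
    Module.Finite.iff_fg.2 (homogeneousSubmodule_fg σ R d)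
  exact Module.Finite.of_injective _ (Submodule.inclusion_injective hV)

theorem finrank_homogeneousSubmodule (σ R : Type*) [Fintype σ] [CommRing R] [Nontrivial R]
    (d : ℕ) :
    Module.finrank R (homogeneousSubmodule σ R d) = (Fintype.card σ).multichoose d := by
  classical
  have hexp : {u : σ →₀ ℕ | u.degree = d} = ↑(finsuppAntidiag (univ : Finset σ) d) := by
    ext u
    simp [mem_finsuppAntidiag, Finsupp.degree_eq_sum]
  rw [homogeneousSubmodule_eq_finsupp_supported, hexp,
    (AddMonoidAlgebra.supportedEquivFinsupp _).finrank_eq, Module.finrank_finsupp_self]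
  simp [card_finsuppAntidiag_nat_eq_multichoose]

variable {σ k : Type*} [Fintype σ] [DecidableEq σ] [Field k] (m : MonomialOrder σ) {d : ℕ}
  {V W : Submodule k (MvPolynomial σ k)}

open scoped Classical in
/-- The leading monomials of degree `d` of the nonzero members of `V`, encoded by their exponent
vectors. -/
noncomputable def leadingExponents (V : Submodule k (MvPolynomial σ k)) (d : ℕ) :
    Finset (σ → ℕ) :=
  {u ∈ monomialsOfDegree σ d | ∃ f ∈ V, f ≠ 0 ∧ ⇑(m.degree f) = u}

theorem mem_leadingExponents {u : σ → ℕ} : u ∈ leadingExponents m V d ↔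
    u ∈ monomialsOfDegree σ d ∧ ∃ f ∈ V, f ≠ 0 ∧ ⇑(m.degree f) = u := by
  simp [leadingExponents]

theorem leadingExponents_subset_monomialsOfDegree (V : Submodule k (MvPolynomial σ k)) (d : ℕ) :
    leadingExponents m V d ⊆ monomialsOfDegree σ d := fun _ hu =>
  ((mem_leadingExponents m).1 hu).1

theorem degree_mem_leadingExponents (hV : V ≤ homogeneousSubmodule σ k d)
    {f : MvPolynomial σ k} (hf : f ∈ V) (hf0 : f ≠ 0) :
    ⇑(m.degree f) ∈ leadingExponents m V d := by
  refine (mem_leadingExponents m).2 ⟨mem_monomialsOfDegree.2 ?_, f, hf, hf0, rfl⟩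
  rw [← Finsupp.degree_eq_sum, Finsupp.degree_eq_weight_one]
  exact (mem_homogeneousSubmodule d f).1 (hV hf) (m.coeff_degree_ne_zero_iff.2 hf0)

-- A member of `V` all of whose coefficients at leading exponents of `V` vanish has no leading term.
theorem finrank_eq_card_leadingExponents (hV : V ≤ homogeneousSubmodule σ k d) :
    Module.finrank k V = #(leadingExponents m V d) := by
  have := finite_of_le_homogeneousSubmodule hV
  apply le_antisymm
  · let φ : V →ₗ[k] leadingExponents m V d → k :=
      LinearMap.pi fun u => lcoeff k (Finsupp.equivFunOnFinite.symm u.1) ∘ₗ V.subtype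
    have hφ : Function.Injective φ := (injective_iff_map_eq_zero φ).2 fun f hf => by
      by_contra hf0
      have hf0' : (f : MvPolynomial σ k) ≠ 0 := Submodule.coe_eq_zero.not.2 hf0
      have hcoeff := congrFun hf ⟨_, degree_mem_leadingExponents m hV f.2 hf0'⟩
      exact m.coeff_degree_ne_zero_iff.2 hf0' (by simpa [φ] using hcoeff)
    simpa using LinearMap.finrank_le_finrank_of_injective hφ
  · choose f hfV hf0 hfu using fun u : leadingExponents m V d => ((mem_leadingExponents m).1 u.2).2
    have hli := linearIndependent_of_injective_degree m hf0 fun u v h =>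
      Subtype.ext ((hfu u).symm.trans ((congrArg DFunLike.coe h).trans (hfu v)))
    have hliV : LinearIndependent k fun u => (⟨f u, hfV u⟩ : V) := .of_comp V.subtype hli
    simpa using hliV.fintype_card_le_finrank

theorem upperShadow_leadingExponents_subset (hVW : ∀ f ∈ V, ∀ i, f * X i ∈ W) :
    upperShadow (leadingExponents m V d) ⊆ leadingExponents m W (d + 1) := by
  refine upperShadow_subset_iff.2 fun u hu i => ?_
  obtain ⟨hud, f, hf, hf0, rfl⟩ := (mem_leadingExponents m).1 hu
  refine (mem_leadingExponents m).2 ⟨add_single_mem_monomialsOfDegree.2 hud, f * X i, hVW f hf i,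
    mul_ne_zero hf0 (X_ne_zero i), ?_⟩
  rw [m.degree_mul hf0 (X_ne_zero i), m.degree_X, Finsupp.coe_add, Finsupp.single_eq_pi_single]

end LeadingExponents

section Components

variable {k : Type*} [Field k] {n : ℕ} (I : Ideal (MvPolynomial (Fin n) k)) (d : ℕ)

theorem mul_X_mem_idealComponent {f : MvPolynomial (Fin n) k} (hf : f ∈ idealComponent I d)
    (i : Fin n) : f * MvPolynomial.X i ∈ idealComponent I (d + 1) :=
  ⟨I.mul_mem_right _ hf.1, hf.2.mul (MvPolynomial.isHomogeneous_X k i)⟩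

theorem finrank_quotientComponent_add_finrank_idealComponent :
    Module.finrank k (quotientComponent I d) + Module.finrank k (idealComponent I d) =
      n.multichoose d := by
  set S := MvPolynomial.homogeneousSubmodule (Fin n) k d
  have : Module.Finite k S := finite_of_le_homogeneousSubmodule le_rfl
  set π := (Ideal.Quotient.mkₐ k I).toLinearMap
  have hker : (LinearMap.ker (π.domRestrict S)).map S.subtype = idealComponent I d := by
    rw [LinearMap.ker_domRestrict, Submodule.map_comap_subtype, idealComponent, inf_comm]
    congr 1
    ext f
    exact Ideal.Quotient.eq_zero_iff_mem
  have hrank := LinearMap.finrank_range_add_finrank_ker (π.domRestrict S)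
  rwa [LinearMap.range_domRestrict, ← Submodule.finrank_map_subtype_eq, hker,
    finrank_homogeneousSubmodule, Fintype.card_fin] at hrank

theorem exists_card_eq_finrank_idealComponent :
    ∃ A ⊆ monomialsOfDegree (Fin n) d, #A = Module.finrank k (idealComponent I d) ∧
      #(upperShadow A) ≤ Module.finrank k (idealComponent I (d + 1)) := by
  refine ⟨leadingExponents .lex (idealComponent I d) d,
    leadingExponents_subset_monomialsOfDegree _ _ _,
    (finrank_eq_card_leadingExponents _ inf_le_right).symm, ?_⟩
  rw [finrank_eq_card_leadingExponents .lex (V := idealComponent I (d + 1)) inf_le_right]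
  exact card_le_card (upperShadow_leadingExponents_subset _ fun _ =>
    mul_X_mem_idealComponent I d)

end Components

theorem mainTheorem8_general {k : Type*} [Field k] (n δ : ℕ) (I : Ideal (MvPolynomial (Fin n) k)) :
    (1 ≤ δ →
      (∃! t : Fin δ → ℕ, IsMacaulayRep δ (Module.finrank k (quotientComponent I δ)) t) ∧
      ∀ t : Fin δ → ℕ, IsMacaulayRep δ (Module.finrank k (quotientComponent I δ)) t →
        Module.finrank k (quotientComponent I (δ + 1)) ≤
          ∑ j : Fin δ, (t j + 1).choose ((j + 1) + 1)) ∧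
    (2 ≤ n →
      (∃! s : Fin (n - 1) → ℕ,
        IsMacaulayRep (n - 1) (Module.finrank k (idealComponent I δ)) s) ∧
      ∀ s : Fin (n - 1) → ℕ,
        IsMacaulayRep (n - 1) (Module.finrank k (idealComponent I δ)) s →
        ∑ j : Fin (n - 1), (if (j : ℕ) + 1 ≤ s j then (s j + 1).choose (j + 1) else 0) ≤
          Module.finrank k (idealComponent I (δ + 1))) := by
  have hrank := finrank_quotientComponent_add_finrank_idealComponent I
  obtain ⟨A, hA, hcard, hshadow⟩ := exists_card_eq_finrank_idealComponent I δ
  refine ⟨fun hδ => ⟨existsUnique_isMacaulayRep (by omega) _, fun t ht => ?_⟩,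
    fun hn => ⟨existsUnique_isMacaulayRep (by omega) _, fun s hs => ?_⟩⟩
  · have hgrowth := multichoose_le_card_upperShadow_add hA ht <| by rw [hcard, add_comm, hrank]
    rw [← hrank (δ + 1)] at hgrowth
    omega
  · obtain ⟨p, rfl⟩ := Nat.exists_eq_add_of_le' (one_le_two.trans hn)
    exact (sum_choose_le_card_upperShadow hA (hcard ▸ hs)).trans hshadow

theorem mainTheorem8 {k : Type*} [Field k] (n δ : ℕ) (I : Ideal (MvPolynomial (Fin n) k))
    (hI : I.IsHomogeneous (MvPolynomial.homogeneousSubmodule (Fin n) k)) :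
    -- growth of the quotient
    (1 ≤ δ →
      (∃! t : Fin δ → ℕ, IsMacaulayRep δ (Module.finrank k (quotientComponent I δ)) t) ∧
      ∀ t : Fin δ → ℕ, IsMacaulayRep δ (Module.finrank k (quotientComponent I δ)) t →
        Module.finrank k (quotientComponent I (δ + 1)) ≤
          ∑ j : Fin δ, (t j + 1).choose ((j + 1) + 1)) ∧
    -- growth of the ideal; only the nonvanishing terms of the representation contribute
    (2 ≤ n →
      (∃! s : Fin (n - 1) → ℕ,
        IsMacaulayRep (n - 1) (Module.finrank k (idealComponent I δ)) s) ∧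
      ∀ s : Fin (n - 1) → ℕ,
        IsMacaulayRep (n - 1) (Module.finrank k (idealComponent I δ)) s →
        ∑ j : Fin (n - 1), (if (j : ℕ) + 1 ≤ s j then (s j + 1).choose (j + 1) else 0) ≤
          Module.finrank k (idealComponent I (δ + 1))) :=
  mainTheorem8_general n δ I
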